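/- Let $k$ be a field, $S=k[x_1,\dots,x_n]$, and let $I\subseteq S$ be a monomial ideal, i.e. an ideal generated by monomials. Let $\mathbb{F}$ be the minimal $\mathbb{Z}^n$-graded free resolution of $S/I$ over $S$, and let $\beta_{i,a}(S/I)=\dim_k \operatorname{Tor}_i^S(S/I,k)_a=\dim_k H_i(\mathbb{F}\otimes_S k)_a$, for $a\in\mathbb{N}^n$, be the multigraded Betti numbers and $\beta_{i,j}(S/I)=\sum_{|a|=j}\beta_{i,a}(S/I)$, where $|a|=a_1+\dots+a_n$, the graded Betti numbers of $S/I$. For $0\le i\le \operatorname{pdim} S/I$, where $\operatorname{pdim}$ is the projective dimension over $S$, let $$t_i=\max\{\,j : \beta_{i,j}(S/I)\neq 0\,\}.$$ Then for every $i$ with $2\le i\le \operatorname{pdim} S/I$ the maxima defining $t_1$, $t_{i-1}$ and $t_i$ exist, and $$t_i\le t_1+t_{i-1}.$$ -/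

import Mathlib

open MvPolynomial

noncomputable section

/-- A monomial ideal of `k[x_1, …, x_n]`: an ideal generated by a set of monomials. -/
def IsMonomialIdeal {k : Type*} [Field k] {n : ℕ} (I : Ideal (MvPolynomial (Fin n) k)) : Prop :=
  ∃ A : Set (Fin n →₀ ℕ), I = Ideal.span ((fun a => monomial a (1 : k)) '' A)

/-- The maximal homogeneous ideal `𝔪 = ⟨x_1, …, x_n⟩`. -/
def irrelevantIdeal (k : Type*) [Field k] (n : ℕ) : Ideal (MvPolynomial (Fin n) k) :=
  Ideal.span (Set.range X)

/-- The component of multidegree `a` of the multigraded free module `⨁_h S(-v h)`, whose basis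
element `e_h` has multidegree `v h`: the vectors all of whose terms `c x^u e_h` satisfy
`u + v h = a`. -/
def freePiece {k : Type*} [Field k] {n r : ℕ} (v : Fin r → (Fin n →₀ ℕ)) (a : Fin n →₀ ℕ) :
    Submodule k (Fin r → MvPolynomial (Fin n) k) where
  carrier := {f | ∀ h, ∀ u ∈ (f h).support, u + v h = a}
  zero_mem' := by
    intro h u hu
    simp at hu
  add_mem' := by
    classical
    intro f g hf hg h u hu
    rcases Finset.mem_union.1 (support_add hu) with h1 | h1
    · exact hf h u h1
    · exact hg h u h1
  smul_mem' := by
    intro c f hf h u hu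
    exact hf h u (support_smul hu)

/-- The component of multidegree `a` of `S / I`: the classes of the scalar multiples of the
monomial `x^a`. -/
def quotientPiece {k : Type*} [Field k] {n : ℕ} (I : Ideal (MvPolynomial (Fin n) k))
    (a : Fin n →₀ ℕ) : Set (MvPolynomial (Fin n) k ⧸ I) :=
  Set.range fun c : k => Ideal.Quotient.mk I (monomial a c)

/-- A multigraded resolution `⋯ → F_2 → F_1 → F_0 → S / I → 0` by free modules of finite rank.
The basis elements of `F_i` are indexed by `Fin (rank i)` and have the multidegrees `shift i`. -/
structure MultigradedFreeResolution {k : Type*} [Field k] {n : ℕ}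
    (I : Ideal (MvPolynomial (Fin n) k)) where
  rank : ℕ → ℕ
  shift : ∀ i, Fin (rank i) → (Fin n →₀ ℕ)
  /-- The differential `F_{i+1} → F_i`. -/
  d : ∀ i, (Fin (rank (i + 1)) → MvPolynomial (Fin n) k) →ₗ[MvPolynomial (Fin n) k]
    (Fin (rank i) → MvPolynomial (Fin n) k)
  /-- The augmentation `F_0 → S / I`. -/
  aug : (Fin (rank 0) → MvPolynomial (Fin n) k) →ₗ[MvPolynomial (Fin n) k]
    (MvPolynomial (Fin n) k ⧸ I)
  /-- The differentials and the augmentation preserve multidegrees. -/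
  d_single_mem : ∀ i g, d i (Pi.single g 1) ∈ freePiece (shift i) (shift (i + 1) g)
  aug_single_mem : ∀ g, aug (Pi.single g 1) ∈ quotientPiece I (shift 0 g)
  aug_surjective : Function.Surjective aug
  exact_zero : Function.Exact (d 0) aug
  exact_succ : ∀ i, Function.Exact (d (i + 1)) (d i)

namespace MultigradedFreeResolution

/-- The resolution is minimal: every differential maps `F_{i+1}` into `𝔪 F_i`. -/
def IsMinimal {k : Type*} [Field k] {n : ℕ} {I : Ideal (MvPolynomial (Fin n) k)}
    (F : MultigradedFreeResolution I) : Prop :=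
  ∀ i, LinearMap.range (F.d i) ≤
    irrelevantIdeal k n • (⊤ : Submodule _ (Fin (F.rank i) → MvPolynomial (Fin n) k))

/-- Elements of `F_i` of multidegree `a` that represent cycles of the complex
`F ⊗ k = F / 𝔪 F`. -/
def torCycles {k : Type*} [Field k] {n : ℕ} {I : Ideal (MvPolynomial (Fin n) k)}
    (F : MultigradedFreeResolution I) :
    ∀ i : ℕ, (Fin n →₀ ℕ) → Submodule k (Fin (F.rank i) → MvPolynomial (Fin n) k)
  | 0, a => freePiece (F.shift 0) a
  | i + 1, a => freePiece (F.shift (i + 1)) a ⊓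
      (((irrelevantIdeal k n • (⊤ : Submodule (MvPolynomial (Fin n) k)
        (Fin (F.rank i) → MvPolynomial (Fin n) k))).comap (F.d i)).restrictScalars k)

/-- Elements of `F_i` of multidegree `a` that represent boundaries of the complex
`F ⊗ k = F / 𝔪 F`. -/
def torBoundaries {k : Type*} [Field k] {n : ℕ} {I : Ideal (MvPolynomial (Fin n) k)}
    (F : MultigradedFreeResolution I) (i : ℕ) (a : Fin n →₀ ℕ) :
    Submodule k (Fin (F.rank i) → MvPolynomial (Fin n) k) :=
  freePiece (F.shift i) a ⊓
    ((irrelevantIdeal k n • (⊤ : Submodule (MvPolynomial (Fin n) k)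
      (Fin (F.rank i) → MvPolynomial (Fin n) k)) ⊔
        LinearMap.range (F.d i)).restrictScalars k)

/-- The multigraded Betti number `β_{i,a}(S/I) = dim_k Tor_i(S/I, k)_a`, where `Tor_i(S/I, k)_a`
is the component of multidegree `a` of the homology `H_i(F ⊗ k)`. -/
def multigradedBetti {k : Type*} [Field k] {n : ℕ} {I : Ideal (MvPolynomial (Fin n) k)}
    (F : MultigradedFreeResolution I) (i : ℕ) (a : Fin n →₀ ℕ) : ℕ :=
  Module.finrank k (F.torCycles i a ⧸ (F.torBoundaries i a).submoduleOf (F.torCycles i a))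

/-- The graded Betti number `β_{i,j}(S/I) = dim_k Tor_i(S/I, k)_j`: the sum of the multigraded
Betti numbers `β_{i,a}(S/I)` over the finitely many `a ∈ ℕ^n` of total degree `j`. -/
def gradedBetti {k : Type*} [Field k] {n : ℕ} {I : Ideal (MvPolynomial (Fin n) k)}
    (F : MultigradedFreeResolution I) (i j : ℕ) : ℕ :=
  ∑ a ∈ Finset.finsuppAntidiag (Finset.univ : Finset (Fin n)) j, F.multigradedBetti i a

/-- The maximal shift `t_i = max {j : β_{i,j}(S/I) ≠ 0}`. -/
def maxShift {k : Type*} [Field k] {n : ℕ} {I : Ideal (MvPolynomial (Fin n) k)}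
    (F : MultigradedFreeResolution I) (i : ℕ) : ℕ :=
  sSup {j | F.gradedBetti i j ≠ 0}

end MultigradedFreeResolution

end

/-! Let `e` be a basis element of `F_i` of multidegree `a` with `|a| = t_i`, and let `F_{≤a}` be the
subcomplex spanned by the basis elements of multidegree at most `a`. It is exact in positive degrees
(`exists_d_eq_of_d_eq_zero`): a homogeneous cycle in it is a monomial times a cycle of multidegree
at most `a`, and a homogeneous preimage of the latter stays in `F_{≤a}`.

For `c ≤ a` with `x^c ∈ I`, multiplication by `x^c` is therefore null-homotopic on `F_{≤a}`, by a
homotopy `H` that raises multidegrees by `c` (`exists_homotopy`). Compare the coefficients of `e` in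
`x^c e = H(d e) + d(w)` with `w ∈ F_{≤a}`. By minimality `d(w)` contributes nothing, because `e`
already has the largest multidegree allowed. So `e` occurs in `H(g)` for some basis element `g` of
`F_{i-1}`, which forces `a ≤ deg g + c` (`exists_shift_le_add`). Taking for `c` the multidegree of a
basis element of `F_1` below `a` and passing to total degrees gives the bound. -/

/-! ### Homogeneous components of multigraded free modules -/

section FreePiece

variable {k : Type*} [Field k] {n r s : ℕ}

theorem mem_freePiece_iff {v : Fin r → (Fin n →₀ ℕ)} {a : Fin n →₀ ℕ}
    {f : Fin r → MvPolynomial (Fin n) k} :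
    f ∈ freePiece v a ↔ ∀ h u, coeff u (f h) ≠ 0 → u + v h = a := by
  constructor
  · intro hf h u hu
    exact hf h u (mem_support_iff.2 hu)
  · intro hf h u hu
    exact hf h u (mem_support_iff.1 hu)

theorem le_of_mem_freePiece {v : Fin r → (Fin n →₀ ℕ)} {a : Fin n →₀ ℕ}
    {f : Fin r → MvPolynomial (Fin n) k} (hf : f ∈ freePiece v a) {h : Fin r} (hh : f h ≠ 0) :
    v h ≤ a := by
  obtain ⟨u, hu⟩ := exists_coeff_ne_zero hh
  exact (mem_freePiece_iff.1 hf h u hu) ▸ le_add_self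

theorem eq_monomial_of_mem_freePiece {v : Fin r → (Fin n →₀ ℕ)} {a : Fin n →₀ ℕ}
    {f : Fin r → MvPolynomial (Fin n) k} (hf : f ∈ freePiece v a) (h : Fin r) :
    f h = monomial (a - v h) (coeff (a - v h) (f h)) := by
  classical
  ext u
  rw [coeff_monomial]
  split_ifs with hu
  · rw [hu]
  · by_contra hne
    exact hu (by rw [← mem_freePiece_iff.1 hf h u hne, add_tsub_cancel_right])

theorem monomial_smul_mem_freePiece {v : Fin r → (Fin n →₀ ℕ)} {a : Fin n →₀ ℕ}
    {f : Fin r → MvPolynomial (Fin n) k} (hf : f ∈ freePiece v a) (u : Fin n →₀ ℕ) (c : k) :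
    monomial u c • f ∈ freePiece v (u + a) := by
  classical
  rw [mem_freePiece_iff] at hf ⊢
  intro h w hw
  rw [Pi.smul_apply, smul_eq_mul, coeff_monomial_mul'] at hw
  split_ifs at hw with huw
  · have := hf h (w - u) (right_ne_zero_of_mul hw)
    rw [← this, ← add_assoc, add_tsub_cancel_of_le huw]
  · exact absurd rfl hw

theorem single_mem_freePiece (v : Fin r → (Fin n →₀ ℕ)) (h : Fin r) :
    (Pi.single h 1 : Fin r → MvPolynomial (Fin n) k) ∈ freePiece v (v h) := by
  classical
  rw [mem_freePiece_iff]
  intro g u hu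
  by_cases hg : g = h
  · subst hg
    rw [Pi.single_eq_same, coeff_one] at hu
    split_ifs at hu with h0
    · rw [← h0, zero_add]
    · exact absurd rfl hu
  · simp [Pi.single_eq_of_ne hg] at hu

theorem single_monomial_eq (h : Fin r) (u : Fin n →₀ ℕ) (c : k) :
    (Pi.single h (monomial u c) : Fin r → MvPolynomial (Fin n) k) =
      monomial u c • Pi.single h 1 := by
  rw [← Pi.single_smul, smul_eq_mul, mul_one]

theorem eq_sum_smul_single {R : Type*} [CommRing R] (f : Fin r → R) :
    f = ∑ h, f h • (Pi.single h 1 : Fin r → R) := by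
  simpa using pi_eq_sum_univ' f

theorem map_eq_sum {R M : Type*} [CommRing R] [AddCommGroup M] [Module R M]
    (d : (Fin r → R) →ₗ[R] M) (f : Fin r → R) :
    d f = ∑ h, f h • d (Pi.single h 1) := by
  conv_lhs => rw [eq_sum_smul_single f, map_sum]
  simp only [map_smul]

/-- The condition is imposed only on basis elements occurring in `f`, since the homotopies are
controlled only on those of multidegree at most `a`. -/
theorem map_mem_freePiece_add {v : Fin r → (Fin n →₀ ℕ)}
    {w : Fin s → (Fin n →₀ ℕ)}
    {d : (Fin s → MvPolynomial (Fin n) k) →ₗ[MvPolynomial (Fin n) k]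
      (Fin r → MvPolynomial (Fin n) k)} {c : Fin n →₀ ℕ} {a : Fin n →₀ ℕ}
    {f : Fin s → MvPolynomial (Fin n) k} (hf : f ∈ freePiece w a)
    (hd : ∀ g, f g ≠ 0 → d (Pi.single g 1) ∈ freePiece v (w g + c)) :
    d f ∈ freePiece v (a + c) := by
  rw [map_eq_sum]
  refine Submodule.sum_mem _ fun g _ => ?_
  by_cases hg : f g = 0
  · rw [hg, zero_smul]
    exact Submodule.zero_mem _
  · have := monomial_smul_mem_freePiece (hd g hg) (a - w g) (coeff (a - w g) (f g))
    rwa [← eq_monomial_of_mem_freePiece hf, ← add_assoc,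
      tsub_add_cancel_of_le (le_of_mem_freePiece hf hg)] at this

/-- The projection of the multigraded free module `⨁_h S(-v h)` onto its component of
multidegree `b`. -/
noncomputable def homogeneousPart (v : Fin r → (Fin n →₀ ℕ)) (b : Fin n →₀ ℕ) :
    (Fin r → MvPolynomial (Fin n) k) →ₗ[k] (Fin r → MvPolynomial (Fin n) k) :=
  open Classical in
  LinearMap.pi fun h => if v h ≤ b then
    monomial (b - v h) ∘ₗ lcoeff k (b - v h) ∘ₗ LinearMap.proj h else 0

theorem homogeneousPart_apply_of_le {v : Fin r → (Fin n →₀ ℕ)} {b : Fin n →₀ ℕ} {h : Fin r}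
    (hb : v h ≤ b) (f : Fin r → MvPolynomial (Fin n) k) :
    homogeneousPart v b f h = monomial (b - v h) (coeff (b - v h) (f h)) := by
  simp [homogeneousPart, hb]

theorem homogeneousPart_apply_of_not_le {v : Fin r → (Fin n →₀ ℕ)} {b : Fin n →₀ ℕ} {h : Fin r}
    (hb : ¬ v h ≤ b) (f : Fin r → MvPolynomial (Fin n) k) :
    homogeneousPart v b f h = 0 := by
  simp [homogeneousPart, hb]

theorem homogeneousPart_mem (v : Fin r → (Fin n →₀ ℕ)) (b : Fin n →₀ ℕ)
    (f : Fin r → MvPolynomial (Fin n) k) : homogeneousPart v b f ∈ freePiece v b := by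
  classical
  rw [mem_freePiece_iff]
  intro h u hu
  by_cases hb : v h ≤ b
  · rw [homogeneousPart_apply_of_le hb, coeff_monomial] at hu
    split_ifs at hu with h0
    · rw [← h0, tsub_add_cancel_of_le hb]
    · exact absurd rfl hu
  · rw [homogeneousPart_apply_of_not_le hb] at hu
    simp at hu

theorem homogeneousPart_of_mem {v : Fin r → (Fin n →₀ ℕ)} {b : Fin n →₀ ℕ}
    {f : Fin r → MvPolynomial (Fin n) k} (hf : f ∈ freePiece v b) :
    homogeneousPart v b f = f := by
  funext h
  by_cases hb : v h ≤ b
  · rw [homogeneousPart_apply_of_le hb, ← eq_monomial_of_mem_freePiece hf]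
  · rw [homogeneousPart_apply_of_not_le hb]
    by_contra hne
    exact hb (le_of_mem_freePiece hf (Ne.symm hne))

theorem homogeneousPart_of_mem_of_ne {v : Fin r → (Fin n →₀ ℕ)} {b b' : Fin n →₀ ℕ}
    {f : Fin r → MvPolynomial (Fin n) k} (hf : f ∈ freePiece v b') (hne : b' ≠ b) :
    homogeneousPart v b f = 0 := by
  funext h
  by_cases hb : v h ≤ b
  · rw [homogeneousPart_apply_of_le hb, Pi.zero_apply, monomial_eq_zero]
    by_contra hc
    exact hne (by rw [← mem_freePiece_iff.1 hf h _ hc, tsub_add_cancel_of_le hb])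
  · rw [homogeneousPart_apply_of_not_le hb, Pi.zero_apply]

theorem map_mem_freePiece {v : Fin r → (Fin n →₀ ℕ)} {w : Fin s → (Fin n →₀ ℕ)}
    {d : (Fin s → MvPolynomial (Fin n) k) →ₗ[MvPolynomial (Fin n) k]
      (Fin r → MvPolynomial (Fin n) k)} (hd : ∀ g, d (Pi.single g 1) ∈ freePiece v (w g))
    {a : Fin n →₀ ℕ} {f : Fin s → MvPolynomial (Fin n) k} (hf : f ∈ freePiece w a) :
    d f ∈ freePiece v a := by
  have := map_mem_freePiece_add (c := 0) hf fun g _ => by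
    simpa using hd g
  simpa using this

theorem map_homogeneousPart {v : Fin r → (Fin n →₀ ℕ)} {w : Fin s → (Fin n →₀ ℕ)}
    {d : (Fin s → MvPolynomial (Fin n) k) →ₗ[MvPolynomial (Fin n) k]
      (Fin r → MvPolynomial (Fin n) k)} (hd : ∀ g, d (Pi.single g 1) ∈ freePiece v (w g))
    (b : Fin n →₀ ℕ) (f : Fin s → MvPolynomial (Fin n) k) :
    d (homogeneousPart w b f) = homogeneousPart v b (d f) := by
  suffices h : d.restrictScalars k ∘ₗ homogeneousPart w b =
      homogeneousPart v b ∘ₗ d.restrictScalars k from LinearMap.congr_fun h f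
  refine LinearMap.pi_ext' fun g => linearMap_ext fun u => LinearMap.ext_ring ?_
  simp only [LinearMap.comp_apply, LinearMap.single_apply, LinearMap.restrictScalars_apply]
  rw [single_monomial_eq]
  have hm := monomial_smul_mem_freePiece (single_mem_freePiece w g) u (1 : k)
  by_cases hb : u + w g = b
  · rw [hb] at hm
    rw [homogeneousPart_of_mem hm, homogeneousPart_of_mem (map_mem_freePiece hd hm)]
  · rw [homogeneousPart_of_mem_of_ne hm hb, map_zero,
      homogeneousPart_of_mem_of_ne (map_mem_freePiece hd hm) hb]

/-- A homogeneous vector that involves only basis elements of multidegree at most `a` is a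
monomial multiple of a homogeneous vector of multidegree at most `a`. -/
theorem exists_eq_monomial_smul {v : Fin r → (Fin n →₀ ℕ)} {a b : Fin n →₀ ℕ}
    {z : Fin r → MvPolynomial (Fin n) k} (hz : z ∈ freePiece v b)
    (hza : ∀ h, z h ≠ 0 → v h ≤ a) :
    ∃ z' ∈ freePiece v (b ⊓ a), z = monomial (b - b ⊓ a) (1 : k) • z' := by
  classical
  -- Where `z h = 0`, `v h ≤ b ⊓ a` may fail and the truncated subtraction would be meaningless,
  -- hence the case split.
  refine ⟨fun h => if z h = 0 then 0 else monomial (b ⊓ a - v h) (coeff (b - v h) (z h)), ?_, ?_⟩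
  · rw [mem_freePiece_iff]
    intro h u hu
    split_ifs at hu with h0
    · simp at hu
    · rw [coeff_monomial] at hu
      split_ifs at hu with h1
      · rw [← h1, tsub_add_cancel_of_le (le_inf (le_of_mem_freePiece hz h0) (hza h h0))]
      · exact absurd rfl hu
  · funext h
    rw [Pi.smul_apply]
    split_ifs with h0
    · rw [h0, smul_zero]
    · rw [smul_eq_mul, monomial_mul, one_mul,
        tsub_add_tsub_cancel inf_le_left (le_inf (le_of_mem_freePiece hz h0) (hza h h0))]
      exact eq_monomial_of_mem_freePiece hz h

end FreePiece

/-! ### The irrelevant ideal and constant coefficients -/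

section Irrelevant

variable {k : Type*} [Field k] {n r : ℕ}

theorem mem_irrelevantIdeal_iff {p : MvPolynomial (Fin n) k} :
    p ∈ irrelevantIdeal k n ↔ coeff 0 p = 0 := by
  rw [irrelevantIdeal, ← Set.image_univ, mem_ideal_span_X_image]
  constructor
  · intro h
    by_contra h0
    obtain ⟨i, -, hi⟩ := h 0 (mem_support_iff.2 h0)
    exact hi rfl
  · intro h m hm
    have : m ≠ 0 := by
      rintro rfl
      exact mem_support_iff.1 hm h
    obtain ⟨i, hi⟩ := Finsupp.ne_iff.1 this
    exact ⟨i, Set.mem_univ _, hi⟩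

theorem mem_irrelevantIdeal_smul_top_iff {f : Fin r → MvPolynomial (Fin n) k} :
    f ∈ irrelevantIdeal k n • (⊤ : Submodule (MvPolynomial (Fin n) k)
      (Fin r → MvPolynomial (Fin n) k)) ↔ ∀ h, coeff 0 (f h) = 0 := by
  constructor
  · intro hf h
    rw [← mem_irrelevantIdeal_iff]
    have := Submodule.mem_map_of_mem (f := LinearMap.proj (R := MvPolynomial (Fin n) k) h) hf
    rw [Submodule.map_smul''] at this
    exact Submodule.smul_le.2 (fun p hp q _ => Ideal.mul_mem_right q _ hp) this
  · intro hf
    rw [eq_sum_smul_single f]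
    exact Submodule.sum_mem _ fun h _ =>
      Submodule.smul_mem_smul (mem_irrelevantIdeal_iff.2 (hf h)) trivial

theorem finiteDimensional_freePiece (v : Fin r → (Fin n →₀ ℕ)) (a : Fin n →₀ ℕ) :
    FiniteDimensional k (freePiece (k := k) v a) := by
  let φ : freePiece (k := k) v a →ₗ[k] (Fin r → k) :=
    (LinearMap.pi fun h => lcoeff k (a - v h) ∘ₗ LinearMap.proj h) ∘ₗ Submodule.subtype _
  refine FiniteDimensional.of_injective φ ((injective_iff_map_eq_zero φ).2 fun f hf => ?_)
  ext1
  funext h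
  rw [eq_monomial_of_mem_freePiece f.2 h]
  have : coeff (a - v h) (f.1 h) = 0 := congrFun hf h
  rw [this, monomial_zero]
  rfl

theorem IsMonomialIdeal.coeff_zero_eq_zero {I : Ideal (MvPolynomial (Fin n) k)}
    (hI : IsMonomialIdeal I) (hne : I ≠ ⊤) {p : MvPolynomial (Fin n) k} (hp : p ∈ I) :
    coeff 0 p = 0 := by
  classical
  rw [← mem_irrelevantIdeal_iff]
  obtain ⟨A, rfl⟩ := hI
  refine Ideal.span_le.2 ?_ hp
  rintro _ ⟨a, ha, rfl⟩
  rw [SetLike.mem_coe, mem_irrelevantIdeal_iff, coeff_monomial, if_neg]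
  rintro rfl
  exact hne ((Ideal.eq_top_iff_one _).2 (Ideal.subset_span ⟨0, ha, rfl⟩))

end Irrelevant

theorem exists_map_single_apply_ne_zero {R : Type*} [CommRing R] {r s : ℕ}
    (d : (Fin s → R) →ₗ[R] (Fin r → R)) {f : Fin s → R} {h : Fin r} (hh : d f h ≠ 0) :
    ∃ g, f g ≠ 0 ∧ d (Pi.single g 1) h ≠ 0 := by
  rw [map_eq_sum, Finset.sum_apply] at hh
  obtain ⟨g, -, hg⟩ := Finset.exists_ne_zero_of_sum_ne_zero hh
  exact ⟨g, left_ne_zero_of_mul hg, right_ne_zero_of_mul hg⟩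

/-! ### The subcomplex below a multidegree and its null-homotopies -/

namespace MultigradedFreeResolution

variable {k : Type*} [Field k] {n : ℕ} {I : Ideal (MvPolynomial (Fin n) k)}
  (F : MultigradedFreeResolution I)

theorem d_d (i : ℕ) (f : Fin (F.rank (i + 2)) → MvPolynomial (Fin n) k) :
    F.d i (F.d (i + 1) f) = 0 :=
  (F.exact_succ i).apply_apply_eq_zero f

theorem shift_le_of_d_single_ne_zero {i : ℕ} {g : Fin (F.rank (i + 1))} {h : Fin (F.rank i)}
    (hh : F.d i (Pi.single g 1) h ≠ 0) : F.shift i h ≤ F.shift (i + 1) g :=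
  le_of_mem_freePiece (F.d_single_mem i g) hh

/-- A boundary of multidegree `b ≤ a`, multiplied by a monomial, is the image of a homogeneous
vector that only involves basis elements of multidegree at most `a`. -/
theorem exists_d_eq_monomial_smul {i : ℕ} {a b : Fin n →₀ ℕ} (hb : b ≤ a)
    {z : Fin (F.rank i) → MvPolynomial (Fin n) k} (hz : z ∈ freePiece (F.shift i) b)
    (hzd : ∃ w, F.d i w = z) (u : Fin n →₀ ℕ) :
    ∃ w ∈ freePiece (F.shift (i + 1)) (u + b), (∀ h, w h ≠ 0 → F.shift (i + 1) h ≤ a) ∧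
      F.d i w = monomial u (1 : k) • z := by
  obtain ⟨w, rfl⟩ := hzd
  -- Basis elements occurring in a vector of multidegree `b` have multidegree at most `b ≤ a`.
  refine ⟨monomial u 1 • homogeneousPart (F.shift (i + 1)) b w,
    monomial_smul_mem_freePiece (homogeneousPart_mem _ _ _) _ _, fun h hh => ?_, ?_⟩
  · exact (le_of_mem_freePiece (homogeneousPart_mem _ _ w) (right_ne_zero_of_mul hh)).trans hb
  · rw [map_smul, map_homogeneousPart (F.d_single_mem i), homogeneousPart_of_mem hz]

/-- The subcomplex spanned by the basis elements of multidegree at most `a` is exact in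
positive homological degrees. -/
theorem exists_d_eq_of_d_eq_zero {i : ℕ} {a b : Fin n →₀ ℕ}
    {z : Fin (F.rank (i + 1)) → MvPolynomial (Fin n) k} (hz : z ∈ freePiece (F.shift (i + 1)) b)
    (hza : ∀ h, z h ≠ 0 → F.shift (i + 1) h ≤ a) (hd : F.d i z = 0) :
    ∃ w ∈ freePiece (F.shift (i + 2)) b, (∀ h, w h ≠ 0 → F.shift (i + 2) h ≤ a) ∧
      F.d (i + 1) w = z := by
  obtain ⟨z', hz', rfl⟩ := exists_eq_monomial_smul hz hza
  have hd' : F.d i z' = 0 := by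
    rw [map_smul] at hd
    exact (smul_eq_zero.1 hd).resolve_left (monomial_eq_zero.not.2 one_ne_zero)
  have := F.exists_d_eq_monomial_smul (inf_le_right (a := b) (b := a)) hz'
    ((F.exact_succ i z').1 hd') (b - b ⊓ a)
  rwa [tsub_add_cancel_of_le inf_le_left] at this

/-- The inductive step of the homotopy. Here `z` stands for `x^c - H d` with the previous `H` (for
`x^c` alone when `i = 0`). Lifting `z` through `d` gives the next `H`, and `hzd` makes `x^c - H d`
take cycles as values one degree higher, so exactness lifts it again. -/
theorem exists_homotopy_of_lift {a c : Fin n →₀ ℕ} {i : ℕ}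
    (z : Fin (F.rank i) → (Fin (F.rank i) → MvPolynomial (Fin n) k))
    (hz : ∀ g, F.shift i g ≤ a → ∃ w ∈ freePiece (F.shift (i + 1)) (c + F.shift i g),
      (∀ h, w h ≠ 0 → F.shift (i + 1) h ≤ a) ∧ F.d i w = z g)
    (hzd : ∀ g, ∑ h, F.d i (Pi.single g 1) h • z h =
      monomial c (1 : k) • F.d i (Pi.single g 1)) :
    ∃ H : (Fin (F.rank i) → MvPolynomial (Fin n) k) →ₗ[MvPolynomial (Fin n) k]
        (Fin (F.rank (i + 1)) → MvPolynomial (Fin n) k),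
      (∀ g, F.shift i g ≤ a → H (Pi.single g 1) ∈ freePiece (F.shift (i + 1)) (F.shift i g + c)) ∧
      ∀ g, F.shift (i + 1) g ≤ a → ∃ w ∈ freePiece (F.shift (i + 2)) (c + F.shift (i + 1) g),
        (∀ h, w h ≠ 0 → F.shift (i + 2) h ≤ a) ∧ F.d (i + 1) w =
          monomial c (1 : k) • Pi.single g 1 - H (F.d i (Pi.single g 1)) := by
  classical
  have key : ∀ g, ∃ w, F.shift i g ≤ a → w ∈ freePiece (F.shift (i + 1)) (F.shift i g + c) ∧
      (∀ h, w h ≠ 0 → F.shift (i + 1) h ≤ a) ∧ F.d i w = z g := by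
    intro g
    by_cases hg : F.shift i g ≤ a
    · obtain ⟨w, hw, hwa, hwd⟩ := hz g hg
      exact ⟨w, fun _ => ⟨add_comm c (F.shift i g) ▸ hw, hwa, hwd⟩⟩
    -- Outside the subcomplex nothing is required of `H`; 0 is a filler.
    · exact ⟨0, fun h => absurd h hg⟩
  choose w hw using key
  set H := (Pi.basisFun (MvPolynomial (Fin n) k) _).constr (MvPolynomial (Fin n) k) w with hHdef
  have hH : ∀ g, H (Pi.single g 1) = w g := fun g => by
    rw [hHdef, ← Pi.basisFun_apply, Module.Basis.constr_basis]
  refine ⟨H, fun g hg => ?_, fun g hg => ?_⟩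
  · rw [hH]
    exact (hw g hg).1
  · refine F.exists_d_eq_of_d_eq_zero (Submodule.sub_mem _
      (monomial_smul_mem_freePiece (single_mem_freePiece _ g) c (1 : k)) ?_) ?_ ?_
    · refine (congrArg (fun b => H (F.d i (Pi.single g 1)) ∈ freePiece (F.shift (i + 1)) b)
        (add_comm c (F.shift (i + 1) g))).mpr ?_
      refine map_mem_freePiece_add (F.d_single_mem i g) fun h hh => ?_
      rw [hH]
      exact (hw h ((F.shift_le_of_d_single_ne_zero hh).trans hg)).1
    · intro h hh
      obtain rfl | hne := eq_or_ne h g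
      · exact hg
      · obtain ⟨g', hg', hh'⟩ := exists_map_single_apply_ne_zero H (f := F.d i (Pi.single g 1))
          (h := h) (by
            intro h0
            simp [h0, Pi.single_eq_of_ne hne] at hh)
        rw [hH] at hh'
        exact (hw g' ((F.shift_le_of_d_single_ne_zero hg').trans hg)).2.1 h hh'
    · rw [map_sub, map_smul, ← hzd, map_eq_sum H, map_sum, sub_eq_zero]
      refine Finset.sum_congr rfl fun h _ => ?_
      by_cases h0 : F.d i (Pi.single g 1) h = 0
      · simp [h0]
      · rw [map_smul, hH, (hw h ((F.shift_le_of_d_single_ne_zero h0).trans hg)).2.2]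

/-- Partial null-homotopy of the multiplication by `x^c` on the subcomplex spanned by the basis
elements of multidegree at most `a`. -/
theorem exists_homotopy {a c : Fin n →₀ ℕ} (hca : c ≤ a) (hc : monomial c (1 : k) ∈ I) (i : ℕ) :
    ∃ H : (Fin (F.rank i) → MvPolynomial (Fin n) k) →ₗ[MvPolynomial (Fin n) k]
        (Fin (F.rank (i + 1)) → MvPolynomial (Fin n) k),
      (∀ g, F.shift i g ≤ a → H (Pi.single g 1) ∈ freePiece (F.shift (i + 1)) (F.shift i g + c)) ∧
      ∀ g, F.shift (i + 1) g ≤ a → ∃ w ∈ freePiece (F.shift (i + 2)) (c + F.shift (i + 1) g),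
        (∀ h, w h ≠ 0 → F.shift (i + 2) h ≤ a) ∧ F.d (i + 1) w =
          monomial c (1 : k) • Pi.single g 1 - H (F.d i (Pi.single g 1)) := by
  classical
  induction i with
  | zero =>
    refine F.exists_homotopy_of_lift (fun g => monomial c (1 : k) • Pi.single g 1)
      (fun g hg => ?_) fun g => ?_
    · obtain ⟨z, hz, hze⟩ := exists_eq_monomial_smul (a := a)
        (monomial_smul_mem_freePiece (single_mem_freePiece (F.shift 0) g) c (1 : k)) (by
          intro h hh
          obtain rfl | hne := eq_or_ne h g
          · exact hg
          · simp [Pi.single_eq_of_ne hne] at hh)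
      have hbg : F.shift 0 g ≤ (c + F.shift 0 g) ⊓ a := le_inf le_add_self hg
      -- Here `c ≤ a` enters: after truncation at `a` the multidegree is still at least `c`, so the
      -- image in `S / I` still vanishes.
      have hbc : c ≤ (c + F.shift 0 g) ⊓ a := le_inf le_self_add hca
      have hz1 : z = monomial ((c + F.shift 0 g) ⊓ a - F.shift 0 g) (1 : k) •
          Pi.single g 1 := by
        refine smul_right_injective _ (monomial_eq_zero.not.2 one_ne_zero) (hze.symm.trans ?_)
        dsimp only
        rw [smul_smul, monomial_mul, one_mul, tsub_add_tsub_cancel inf_le_left hbg,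
          add_tsub_cancel_right]
      have haug : F.aug z = 0 := by
        obtain ⟨l, hl⟩ := F.aug_single_mem g
        dsimp only at hl
        rw [hz1, map_smul, ← hl, ← Ideal.Quotient.mkₐ_eq_mk (MvPolynomial (Fin n) k), ← map_smul,
          Ideal.Quotient.mkₐ_eq_mk, smul_eq_mul, monomial_mul, one_mul, tsub_add_cancel_of_le hbg,
          Ideal.Quotient.eq_zero_iff_mem]
        have := I.mul_mem_left (monomial ((c + F.shift 0 g) ⊓ a - c) l) hc
        rwa [monomial_mul, mul_one, tsub_add_cancel_of_le hbc] at this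
      have := F.exists_d_eq_monomial_smul
        (inf_le_right (a := c + F.shift 0 g) (b := a)) hz ((F.exact_zero z).1 haug)
        (c + F.shift 0 g - (c + F.shift 0 g) ⊓ a)
      rwa [tsub_add_cancel_of_le inf_le_left, ← hze] at this
    · conv_rhs => rw [eq_sum_smul_single (F.d 0 (Pi.single g 1)), Finset.smul_sum]
      exact Finset.sum_congr rfl fun h _ => smul_comm _ _ _
  | succ i ih =>
    obtain ⟨H, -, hH⟩ := ih
    refine F.exists_homotopy_of_lift
      (fun g => monomial c (1 : k) • Pi.single g 1 - H (F.d i (Pi.single g 1))) hH fun g => ?_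
    generalize hf : F.d (i + 1) (Pi.single g 1) = f
    have h1 : H (F.d i f) = 0 := by rw [← hf, d_d, map_zero]
    rw [map_eq_sum (F.d i) f, map_sum] at h1
    conv_rhs => rw [eq_sum_smul_single f, Finset.smul_sum]
    simp only [map_smul] at h1
    simp only [smul_sub, Finset.sum_sub_distrib, h1, sub_zero]
    exact Finset.sum_congr rfl fun h _ => smul_comm _ _ _

variable {F}

theorem IsMinimal.coeff_zero_d (hF : F.IsMinimal) (i : ℕ)
    (f : Fin (F.rank (i + 1)) → MvPolynomial (Fin n) k) (h : Fin (F.rank i)) :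
    coeff 0 (F.d i f h) = 0 :=
  mem_irrelevantIdeal_smul_top_iff.1 (hF i ⟨f, rfl⟩) h

/-- By multidegree this entry could only be a constant, and minimality excludes nonzero constants.
-/
theorem IsMinimal.d_single_apply_eq_zero (hF : F.IsMinimal) {i : ℕ} {g : Fin (F.rank (i + 1))}
    {h : Fin (F.rank i)} (hgh : F.shift (i + 1) g ≤ F.shift i h) :
    F.d i (Pi.single g 1) h = 0 := by
  by_contra hne
  obtain ⟨u, hu⟩ := exists_coeff_ne_zero hne
  have h1 := mem_freePiece_iff.1 (F.d_single_mem i g) h u hu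
  have h2 : u = 0 := by
    rw [← h1] at hgh
    exact le_antisymm (by simpa using hgh) zero_le
  exact hu (h2 ▸ hF.coeff_zero_d i _ h)

/-- The multigraded form of subadditivity. -/
theorem IsMinimal.exists_shift_le_add (hF : F.IsMinimal) {i : ℕ} (e : Fin (F.rank (i + 1)))
    {c : Fin n →₀ ℕ} (hca : c ≤ F.shift (i + 1) e) (hc : monomial c (1 : k) ∈ I) :
    ∃ g, F.shift (i + 1) e ≤ F.shift i g + c := by
  obtain ⟨H, hH, hH'⟩ := F.exists_homotopy hca hc i
  obtain ⟨w, -, hwa, hwd⟩ := hH' e le_rfl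
  have h0 : F.d (i + 1) w e = 0 := by
    by_contra hne
    obtain ⟨g, hg, hge⟩ := exists_map_single_apply_ne_zero (F.d (i + 1)) hne
    exact hge (hF.d_single_apply_eq_zero (hwa g hg))
  rw [hwd, Pi.sub_apply, sub_eq_zero, Pi.smul_apply, Pi.single_eq_same, smul_eq_mul, mul_one] at h0
  obtain ⟨g, hg, hge⟩ := exists_map_single_apply_ne_zero H
    (h0 ▸ monomial_eq_zero.not.2 one_ne_zero : H (F.d i (Pi.single e 1)) e ≠ 0)
  exact ⟨g, le_of_mem_freePiece (hH g (F.shift_le_of_d_single_ne_zero hg)) hge⟩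

end MultigradedFreeResolution

namespace MultigradedFreeResolution

/-! ### Nonvanishing of ranks up to the projective dimension -/

section ProjectiveDimension

open CategoryTheory

variable {k : Type*} [Field k] {n : ℕ} {I : Ideal (MvPolynomial (Fin n) k)}
  (F : MultigradedFreeResolution I)

theorem hasProjectiveDimensionLT_of_shortExact.{u} {R : Type u} [CommRing R] {L M N : Type u}
    [AddCommGroup L] [Module R L] [AddCommGroup M] [Module R M] [AddCommGroup N] [Module R N]
    [Module.Projective R M] {f : L →ₗ[R] M} {g : M →ₗ[R] N} (hf : Function.Injective f)
    (hg : Function.Surjective g) (hfg : Function.Exact f g) {m : ℕ}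
    (hL : HasProjectiveDimensionLT (ModuleCat.of R L) m) :
    HasProjectiveDimensionLT (ModuleCat.of R N) (m + 1) := by
  have hS := ModuleCat.shortComplex_shortExact
    (ModuleCat.shortComplexOfCompEqZero f g hfg.linearMap_comp_eq_zero) hfg hf hg
  have : Projective (ModuleCat.of R M) := ModuleCat.projective_of_categoryTheory_projective _
  exact hS.hasProjectiveDimensionLT_X₃ m hL (hasProjectiveDimensionLT_of_ge _ 1 _ (by omega))

/-- Dimension shifting along `0 → im d_{i+1} → F_{i+1} → im d_i → 0`, down to a zero image. -/
theorem hasProjectiveDimensionLT_range_d (j i : ℕ) (h : F.rank (i + 1 + j) = 0) :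
    HasProjectiveDimensionLT (ModuleCat.of (MvPolynomial (Fin n) k) (LinearMap.range (F.d i)))
      j := by
  induction j generalizing i with
  | zero =>
    have : IsEmpty (Fin (F.rank (i + 1))) := by rw [h]; infer_instance
    have : Subsingleton (LinearMap.range (F.d i)) :=
      (F.d i).surjective_rangeRestrict.subsingleton
    exact (ModuleCat.isZero_of_subsingleton _).hasProjectiveDimensionLT_zero
  | succ j ih =>
    refine hasProjectiveDimensionLT_of_shortExact
      (LinearMap.range (F.d (i + 1))).injective_subtype (F.d i).surjective_rangeRestrict
      (fun y => ?_) (ih (i + 1) (by rw [← h]; congr 1; omega))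
    rw [← Subtype.coe_inj, LinearMap.codRestrict_apply, Submodule.coe_zero, F.exact_succ i y]
    simp

theorem hasProjectiveDimensionLT_of_rank_eq_zero {i : ℕ} (h : F.rank (i + 1) = 0) :
    HasProjectiveDimensionLT
      (ModuleCat.of (MvPolynomial (Fin n) k) (MvPolynomial (Fin n) k ⧸ I)) (i + 1) := by
  refine hasProjectiveDimensionLT_of_shortExact (LinearMap.range (F.d 0)).injective_subtype
    F.aug_surjective (fun y => ?_) (F.hasProjectiveDimensionLT_range_d i 0 (by
      rw [zero_add, add_comm, h]))
  rw [F.exact_zero y]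
  simp

theorem rank_ne_zero_of_le_projectiveDimension {i j : ℕ} (hj : j ≠ 0) (hji : j ≤ i)
    (hi : (i : WithBot ℕ∞) ≤ projectiveDimension
      (ModuleCat.of (MvPolynomial (Fin n) k) (MvPolynomial (Fin n) k ⧸ I))) :
    F.rank j ≠ 0 := by
  intro h
  obtain ⟨j, rfl⟩ := Nat.exists_eq_succ_of_ne_zero hj
  have := F.hasProjectiveDimensionLT_of_rank_eq_zero h
  exact (projectiveDimension_ge_iff _ _).1 hi (hasProjectiveDimensionLT_of_ge _ (j + 1) _ hji)

end ProjectiveDimension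

/-! ### Betti numbers and generators of a minimal resolution -/

section Betti

variable {k : Type*} [Field k] {n : ℕ} {I : Ideal (MvPolynomial (Fin n) k)}
  {F : MultigradedFreeResolution I}

theorem IsMinimal.single_notMem_range_d (hF : F.IsMinimal) {i : ℕ}
    {f : Fin (F.rank i) → MvPolynomial (Fin n) k} {h : Fin (F.rank i)} (hf : f h = 1) :
    f ∉ Set.range (F.d i) := by
  rintro ⟨w, rfl⟩
  have := hF.coeff_zero_d i w h
  rw [hf, coeff_zero_one] at this
  exact one_ne_zero this

theorem IsMinimal.exists_d_single_ne_zero (hF : F.IsMinimal) {i : ℕ}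
    (g : Fin (F.rank (i + 1))) : ∃ h, F.d i (Pi.single g 1) h ≠ 0 := by
  by_contra! h0
  exact hF.single_notMem_range_d (Pi.single_eq_same g 1) ((F.exact_succ i _).1 (funext h0))

theorem IsMinimal.exists_shift_one_le (hF : F.IsMinimal) (i : ℕ) (g : Fin (F.rank (i + 1))) :
    ∃ h, F.shift 1 h ≤ F.shift (i + 1) g := by
  induction i with
  | zero => exact ⟨g, le_rfl⟩
  | succ i ih =>
    obtain ⟨g', hg'⟩ := hF.exists_d_single_ne_zero g
    obtain ⟨h, hh⟩ := ih g'
    exact ⟨h, hh.trans (F.shift_le_of_d_single_ne_zero hg')⟩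

/-- The multidegrees of the basis elements of `F_1` are exponents of monomials of `I`. -/
theorem IsMinimal.monomial_shift_one_mem (hF : F.IsMinimal) (hI : IsMonomialIdeal I)
    (g : Fin (F.rank 1)) : monomial (F.shift 1 g) (1 : k) ∈ I := by
  classical
  by_cases htop : I = ⊤
  · exact htop.ge Submodule.mem_top
  choose l hl using F.aug_single_mem
  dsimp only at hl
  have haug : ∀ f, F.aug f = Ideal.Quotient.mk I (∑ h, f h * monomial (F.shift 0 h) (l h)) := by
    intro f
    rw [map_eq_sum, map_sum]
    refine Finset.sum_congr rfl fun h _ => ?_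
    rw [← hl, map_mul]
    rfl
  -- Compare constant coefficients in a preimage of 1; as `I` is proper, they are determined modulo
  -- `I`.
  obtain ⟨h₀, hv, hl0⟩ : ∃ h, F.shift 0 h = 0 ∧ l h ≠ 0 := by
    obtain ⟨p, hp⟩ := F.aug_surjective 1
    rw [haug, ← map_one (Ideal.Quotient.mk I), Ideal.Quotient.eq] at hp
    have h1 := hI.coeff_zero_eq_zero htop hp
    rw [coeff_sub, coeff_zero_one, sub_eq_zero, coeff_sum] at h1
    obtain ⟨h, -, hh⟩ := Finset.exists_ne_zero_of_sum_ne_zero (h1.trans_ne one_ne_zero)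
    rw [← constantCoeff_eq, map_mul, constantCoeff_eq, coeff_monomial] at hh
    have h2 := right_ne_zero_of_mul hh
    split_ifs at h2 with h3
    · exact ⟨h, h3, h2⟩
    · exact absurd rfl h2
  have huniq : ∀ h, h = h₀ := by
    intro h
    by_contra hne
    -- A second generator would be redundant: its image is a monomial multiple of that of `h₀`,
    -- giving a relation with coefficient 1.
    refine hF.single_notMem_range_d (i := 0) (h := h) (f := Pi.single h 1 -
      Pi.single h₀ (monomial (F.shift 0 h) (l h / l h₀))) ?_ ((F.exact_zero _).1 ?_)
    · simp [Pi.single_eq_of_ne hne]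
    · rw [map_sub, single_monomial_eq, map_smul, ← hl, ← hl, hv,
        ← Ideal.Quotient.mkₐ_eq_mk (MvPolynomial (Fin n) k), ← map_smul, ← map_sub, smul_eq_mul,
        monomial_mul, add_zero, div_mul_cancel₀ _ hl0, sub_self, map_zero]
  obtain ⟨h, hh⟩ := hF.exists_d_single_ne_zero g
  obtain rfl := huniq h
  have h0 := haug (F.d 0 (Pi.single g 1))
  rw [Function.Exact.apply_apply_eq_zero F.exact_zero, eq_comm, Ideal.Quotient.eq_zero_iff_mem,
    Fintype.sum_eq_single h fun x hx => absurd (huniq x) hx] at h0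
  have hm := eq_monomial_of_mem_freePiece (F.d_single_mem 0 g) h
  generalize coeff (F.shift 1 g - F.shift 0 h) (F.d 0 (Pi.single g 1) h) = μ at hm
  rw [hm] at h0 hh
  have hμ : μ ≠ 0 := monomial_eq_zero.not.1 hh
  rw [hv, tsub_zero, monomial_mul, add_zero] at h0
  have := I.mul_mem_left (C (μ * l h)⁻¹) h0
  rwa [C_mul_monomial, inv_mul_cancel₀ (mul_ne_zero hμ hl0)] at this

/-- Minimality kills the differentials of `F ⊗ k`, so the homology is `F_i / 𝔪 F_i` in each
multidegree. -/
theorem IsMinimal.multigradedBetti_ne_zero_iff (hF : F.IsMinimal) {i : ℕ} {a : Fin n →₀ ℕ} :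
    F.multigradedBetti i a ≠ 0 ↔ ∃ h, F.shift i h = a := by
  have hle : F.torCycles i a ≤ freePiece (F.shift i) a := by
    cases i with
    | zero => exact le_rfl
    | succ i => exact inf_le_left
  constructor
  · contrapose!
    intro hne
    have : (F.torBoundaries i a).submoduleOf (F.torCycles i a) = ⊤ := by
      refine (Submodule.submoduleOf_eq_top).2 fun f hf => ⟨hle hf, ?_⟩
      refine Submodule.mem_sup_left (mem_irrelevantIdeal_smul_top_iff.2 fun h => ?_)
      by_contra h0
      exact hne h (by simpa using mem_freePiece_iff.1 (hle hf) h 0 h0)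
    have : Subsingleton (F.torCycles i a ⧸ (F.torBoundaries i a).submoduleOf (F.torCycles i a)) :=
      Submodule.Quotient.subsingleton_iff.2 this
    exact Module.finrank_zero_of_subsingleton
  · rintro ⟨h, rfl⟩
    have hmem : Pi.single h 1 ∈ F.torCycles i (F.shift i h) := by
      cases i with
      | zero => exact single_mem_freePiece _ h
      | succ i => exact ⟨single_mem_freePiece _ h, hF i ⟨_, rfl⟩⟩
    have hnot : Pi.single h 1 ∉ F.torBoundaries i (F.shift i h) := by
      rintro ⟨-, hb⟩
      have := sup_le le_rfl (hF i) hb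
      simpa using mem_irrelevantIdeal_smul_top_iff.1 this h
    have := finiteDimensional_freePiece (k := k) (F.shift i) (F.shift i h)
    have : FiniteDimensional k (F.torCycles i (F.shift i h)) :=
      Submodule.finiteDimensional_of_le hle
    have : Nontrivial (F.torCycles i (F.shift i h) ⧸
        (F.torBoundaries i (F.shift i h)).submoduleOf (F.torCycles i (F.shift i h))) := by
      refine Submodule.Quotient.nontrivial_iff.2 fun htop => hnot ?_
      exact Submodule.submoduleOf_eq_top.1 htop hmem
    exact Module.finrank_pos.ne'

theorem IsMinimal.gradedBetti_ne_zero_iff (hF : F.IsMinimal) {i j : ℕ} :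
    F.gradedBetti i j ≠ 0 ↔ ∃ h, (F.shift i h).degree = j := by
  rw [gradedBetti, ne_eq, Finset.sum_eq_zero_iff]
  push Not
  simp only [hF.multigradedBetti_ne_zero_iff, Finset.mem_finsuppAntidiag, Finset.subset_univ,
    and_true, Finsupp.degree_eq_sum]
  constructor
  · rintro ⟨a, ha, h, rfl⟩
    exact ⟨h, ha⟩
  · rintro ⟨h, hh⟩
    exact ⟨_, hh, h, rfl⟩

theorem IsMinimal.isGreatest_maxShift (hF : F.IsMinimal) {i : ℕ} (hi : F.rank i ≠ 0) :
    IsGreatest {j | F.gradedBetti i j ≠ 0} (F.maxShift i) := by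
  have hset : {j | F.gradedBetti i j ≠ 0} = Set.range fun h => (F.shift i h).degree := by
    ext j
    exact hF.gradedBetti_ne_zero_iff
  have hne : {j | F.gradedBetti i j ≠ 0}.Nonempty := by
    rw [hset]
    exact ⟨_, ⟨0, Nat.pos_of_ne_zero hi⟩, rfl⟩
  have hbdd : BddAbove {j | F.gradedBetti i j ≠ 0} := by
    rw [hset]
    exact (Set.finite_range _).bddAbove
  exact ⟨Nat.sSup_mem hne hbdd, fun j hj => le_csSup hbdd hj⟩

end Betti

end MultigradedFreeResolution

/-- The first three conjuncts say that the maxima defining `t_i`, `t_1`, `t_{i-1}` are attained. -/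
theorem corollary4p6 {k : Type*} [Field k] (n : ℕ) (I : Ideal (MvPolynomial (Fin n) k))
    (hI : IsMonomialIdeal I) (F : MultigradedFreeResolution I) (hF : F.IsMinimal)
    (i : ℕ) (h2 : 2 ≤ i)
    (hi : (i : WithBot ℕ∞) ≤ CategoryTheory.projectiveDimension
      (ModuleCat.of (MvPolynomial (Fin n) k) (MvPolynomial (Fin n) k ⧸ I))) :
    IsGreatest {j | F.gradedBetti i j ≠ 0} (F.maxShift i) ∧
    IsGreatest {j | F.gradedBetti 1 j ≠ 0} (F.maxShift 1) ∧
    IsGreatest {j | F.gradedBetti (i - 1) j ≠ 0} (F.maxShift (i - 1)) ∧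
    F.maxShift i ≤ F.maxShift 1 + F.maxShift (i - 1) := by
  have hgt : ∀ j, j ≠ 0 → j ≤ i → IsGreatest {m | F.gradedBetti j m ≠ 0} (F.maxShift j) :=
    fun j hj hji => hF.isGreatest_maxShift (F.rank_ne_zero_of_le_projectiveDimension hj hji hi)
  refine ⟨hgt i (by omega) le_rfl, hgt 1 one_ne_zero (by omega), hgt (i - 1) (by omega)
    (by omega), ?_⟩
  obtain ⟨m, rfl⟩ : ∃ m, i = m + 1 := ⟨i - 1, by omega⟩
  rw [Nat.add_sub_cancel]
  obtain ⟨e, he⟩ := hF.gradedBetti_ne_zero_iff.1 (hgt (m + 1) (by omega) le_rfl).1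
  obtain ⟨p, hp⟩ := hF.exists_shift_one_le m e
  obtain ⟨g, hg⟩ := hF.exists_shift_le_add e hp (hF.monomial_shift_one_mem hI p)
  have hp1 := (hgt 1 one_ne_zero (by omega)).2 (hF.gradedBetti_ne_zero_iff.2 ⟨p, rfl⟩)
  have hg1 := (hgt m (by omega) (by omega)).2 (hF.gradedBetti_ne_zero_iff.2 ⟨g, rfl⟩)
  have hdeg := Finsupp.degree_mono hg
  rw [map_add] at hdeg
  omega
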